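/- Let $B$ be the set of complex power series $f(x)=\sum_{n\ge 0}a_nx^n$ that converge for every $x\in\mathbb R$ and define a bounded function $f:\mathbb R\to\mathbb C$. (Such a series converges on all of $\mathbb C$, so $f$ is identified with an entire function, and $\sum_{n\ge0}|a_n|<\infty$.) For $f\in B$ put $$\|f\|_{\ell^1}=\sum_{n\ge 0}|a_n|,\qquad \|f\|_{\infty,\mathbb R}=\sup_{x\in\mathbb R}|f(x)| .$$ Then: (i) $\|\cdot\|_{\ell^1}$ is a norm on $B$, and $f\mapsto(a_n)_{n\ge0}$ is an isometry of $(B,\|\cdot\|_{\ell^1})$ onto a dense subset of the complete space $\ell^1(\mathbb N,\mathbb C)$. (ii) $\|\cdot\|_{\infty,\mathbb R}$ is a norm on $B$, and $f\mapsto f|_{\mathbb R}$ is an isometry of $(B,\|\cdot\|_{\infty,\mathbb R})$ onto a dense subset of the complete space $C^{\mathrm b}(\mathbb R,\mathbb C)$ of bounded continuous functions $\mathbb R\to\mathbb C$ with the supremum norm. (iii) If $B$ carries the uniform structure of uniform convergence on compact subsets of $\mathbb C$, then sending $f$ to the entire function it defines is a uniform embedding of $B$ onto a dense subset of the complete space of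 all entire functions with uniform convergence on compact subsets of $\mathbb C$. Moreover, the three topologies on $B$ defined by $\|\cdot\|_{\ell^1}$, by $\|\cdot\|_{\infty,\mathbb R}$ and by uniform convergence on compact subsets of $\mathbb C$ are pairwise different. -/

import Mathlib

open Filter Topology
open scoped BoundedContinuousFunction ENNReal UniformConvergence

noncomputable section

/-- A complex power series `∑ aₙ Xⁿ` is bounded on the real line if it converges at every real
`x` (its partial sums have a limit `F x`) and the resulting function `F : ℝ → ℂ` is bounded. -/
def IsBoundedOnReal (f : PowerSeries ℂ) : Prop :=
  ∃ F : ℝ → ℂ,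
    (∀ x : ℝ, Tendsto (fun N : ℕ => ∑ n ∈ Finset.range N, PowerSeries.coeff n f * (x : ℂ) ^ n)
      atTop (𝓝 (F x))) ∧
    ∃ C : ℝ, ∀ x : ℝ, ‖F x‖ ≤ C

/-- The complex vector space of all power series bounded on the real line. -/
def boundedPowerSeries : Submodule ℂ (PowerSeries ℂ) where
  carrier := {f | IsBoundedOnReal f}
  zero_mem' := ⟨0, by simp, 0, by simp⟩
  add_mem' := by
    rintro f g ⟨F, hF, C, hC⟩ ⟨G, hG, D, hD⟩
    refine ⟨F + G, fun x => ?_, C + D, fun x => (norm_add_le _ _).trans (add_le_add (hC x) (hD x))⟩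
    refine ((hF x).add (hG x)).congr fun N => ?_
    simp [add_mul, Finset.sum_add_distrib]
  smul_mem' := by
    rintro c f ⟨F, hF, C, hC⟩
    refine ⟨c • F, fun x => ?_, ‖c‖ * C, fun x => ?_⟩
    · refine ((hF x).const_mul c).congr fun N => ?_
      simp [mul_assoc, Finset.mul_sum]
    · simpa using mul_le_mul_of_nonneg_left (hC x) (norm_nonneg c)

/-- The type of power series bounded on the real line. -/
abbrev BoundedPS : Type := boundedPowerSeries

namespace BoundedPS

/-- The `n`-th coefficient. -/
def coeff (f : BoundedPS) (n : ℕ) : ℂ := PowerSeries.coeff n (f : PowerSeries ℂ)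

/-- The value of the power series at a complex number; the series converges there by
`BoundedPS.summable` below. -/
def eval (f : BoundedPS) (z : ℂ) : ℂ := ∑' n : ℕ, f.coeff n * z ^ n

@[simp] theorem coeff_zero (n : ℕ) : coeff 0 n = 0 := by simp [coeff]

@[simp] theorem coeff_add (f g : BoundedPS) (n : ℕ) :
    coeff (f + g) n = f.coeff n + g.coeff n := by simp [coeff]

@[simp] theorem coeff_neg (f : BoundedPS) (n : ℕ) : coeff (-f) n = -f.coeff n := by simp [coeff]

@[simp] theorem coeff_smul (c : ℂ) (f : BoundedPS) (n : ℕ) :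
    coeff (c • f) n = c * f.coeff n := by simp [coeff]

theorem ext_coeff {f g : BoundedPS} (h : ∀ n, f.coeff n = g.coeff n) : f = g :=
  Subtype.ext (PowerSeries.ext h)

/-- Convergence on the real line implies convergence on the whole complex plane. -/
theorem summable (f : BoundedPS) (z : ℂ) : Summable fun n : ℕ => f.coeff n * z ^ n := by
  obtain ⟨F, hF, -⟩ := f.2
  refine summable_powerSeries_of_norm_lt (w := ((‖z‖ + 1 : ℝ) : ℂ)) (hF _).cauchySeq ?_
  rw [Complex.norm_real, Real.norm_of_nonneg (by positivity)]
  linarith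

theorem summable_norm_coeff (f : BoundedPS) : Summable fun n : ℕ => ‖f.coeff n‖ := by
  simpa using (f.summable 1).norm

theorem eval_bounded (f : BoundedPS) : ∃ C : ℝ, ∀ x : ℝ, ‖f.eval x‖ ≤ C := by
  obtain ⟨F, hF, C, hC⟩ := f.2
  refine ⟨C, fun x => ?_⟩
  have h : f.eval x = F x :=
    tendsto_nhds_unique (f.summable x).hasSum.tendsto_sum_nat (hF x)
  rw [h]
  exact hC x

theorem bddAbove_norm_eval (f : BoundedPS) :
    BddAbove (Set.range fun x : ℝ => ‖f.eval (x : ℂ)‖) := by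
  obtain ⟨C, hC⟩ := f.eval_bounded
  exact ⟨C, by rintro _ ⟨x, rfl⟩; exact hC x⟩

@[simp] theorem eval_zero (z : ℂ) : eval 0 z = 0 := by simp [eval]

@[simp] theorem eval_add (f g : BoundedPS) (z : ℂ) : eval (f + g) z = f.eval z + g.eval z := by
  simp only [eval, coeff_add, add_mul]
  exact (f.summable z).tsum_add (g.summable z)

@[simp] theorem eval_neg (f : BoundedPS) (z : ℂ) : eval (-f) z = -f.eval z := by
  simp [eval, tsum_neg]

@[simp] theorem eval_smul (c : ℂ) (f : BoundedPS) (z : ℂ) : eval (c • f) z = c * f.eval z := by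
  simp only [eval, coeff_smul, mul_assoc]
  exact tsum_mul_left

theorem hasFPowerSeriesOnBall (f : BoundedPS) :
    HasFPowerSeriesOnBall f.eval (FormalMultilinearSeries.ofScalars ℂ f.coeff) 0 ∞ := by
  have hr : (FormalMultilinearSeries.ofScalars ℂ f.coeff).radius = ∞ := by
    refine ENNReal.eq_top_of_forall_nnreal_le fun r =>
      FormalMultilinearSeries.le_radius_of_summable _ ?_
    simpa [FormalMultilinearSeries.ofScalars_norm] using (f.summable (r : ℂ)).norm
  have h := (FormalMultilinearSeries.ofScalars ℂ f.coeff).hasFPowerSeriesOnBall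
    (by rw [hr]; exact ENNReal.zero_lt_top)
  rw [hr] at h
  refine h.congr fun z _ => ?_
  have h2 := FormalMultilinearSeries.ofScalars_sum_eq (E := ℂ) f.coeff z
  simpa [FormalMultilinearSeries.ofScalarsSum, eval] using h2

theorem differentiable_eval (f : BoundedPS) : Differentiable ℂ f.eval := fun z =>
  (f.hasFPowerSeriesOnBall.analyticAt_of_mem (by simp)).differentiableAt

theorem eq_zero_of_eval_real (f : BoundedPS) (h : ∀ x : ℝ, f.eval x = 0) : f = 0 := by
  have ha : AnalyticOnNhd ℂ f.eval Set.univ := fun z _ =>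
    f.hasFPowerSeriesOnBall.analyticAt_of_mem (by simp)
  have hfreq : ∃ᶠ z in 𝓝[≠] (0 : ℂ), f.eval z = 0 := by
    have ht : Tendsto (fun n : ℕ => ((1 / ((n : ℝ) + 1) : ℝ) : ℂ)) atTop (𝓝[≠] 0) := by
      refine tendsto_nhdsWithin_iff.2 ⟨?_, Eventually.of_forall fun n => ?_⟩
      · have := (Complex.continuous_ofReal.tendsto 0).comp
          (tendsto_one_div_add_atTop_nhds_zero_nat (𝕜 := ℝ))
        simpa [Function.comp_def] using this
      · have : (1 / ((n : ℝ) + 1) : ℝ) ≠ 0 := by positivity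
        exact Complex.ofReal_ne_zero.2 this
    exact ht.frequently (Frequently.of_forall fun n => h _)
  have hz : f.eval = 0 := ha.eq_of_frequently_eq analyticOnNhd_const hfreq
  have hp := f.hasFPowerSeriesOnBall.hasFPowerSeriesAt
  rw [hz] at hp
  have h0 := hp.eq_zero
  refine ext_coeff fun n => ?_
  rw [coeff_zero]
  exact congrFun ((FormalMultilinearSeries.ofScalars_series_eq_zero ℂ).1 h0) n

/-! ### The three structures -/

/-- The norm `‖f‖ = ∑ |aₙ|`. -/
def l1Norm : AddGroupNorm BoundedPS where
  toFun f := ∑' n : ℕ, ‖f.coeff n‖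
  map_zero' := by simp
  add_le' f g := by
    rw [← f.summable_norm_coeff.tsum_add g.summable_norm_coeff]
    refine (f + g).summable_norm_coeff.tsum_le_tsum (fun n => ?_)
      (f.summable_norm_coeff.add g.summable_norm_coeff)
    rw [coeff_add]
    exact norm_add_le _ _
  neg' f := by simp
  eq_zero_of_map_eq_zero' f h := by
    have h0 := (hasSum_zero_iff_of_nonneg (fun n => norm_nonneg (f.coeff n))).1
      (h ▸ f.summable_norm_coeff.hasSum)
    exact ext_coeff fun n => by simpa using congrFun h0 n

/-- The norm `‖f‖ = sup_{x ∈ ℝ} |f(x)|`. -/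
def supNorm : AddGroupNorm BoundedPS where
  toFun f := ⨆ x : ℝ, ‖f.eval x‖
  map_zero' := by simp
  add_le' f g := ciSup_le fun x => by
    rw [eval_add]
    exact (norm_add_le _ _).trans
      (add_le_add (le_ciSup f.bddAbove_norm_eval x) (le_ciSup g.bddAbove_norm_eval x))
  neg' f := by simp
  eq_zero_of_map_eq_zero' f h := f.eq_zero_of_eval_real fun x =>
    norm_le_zero_iff.1 ((le_ciSup f.bddAbove_norm_eval x).trans h.le)

/-- Bounded power series, normed by the `ℓ¹` norm of the coefficients. -/
abbrev l1Structure : NormedAddCommGroup BoundedPS := l1Norm.toNormedAddCommGroup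

/-- Bounded power series, normed by the supremum over the real line. -/
abbrev supStructure : NormedAddCommGroup BoundedPS := supNorm.toNormedAddCommGroup

/-- Bounded power series with the uniform structure of uniform convergence, as functions on `ℂ`,
on the compact subsets of `ℂ`. -/
abbrev compactStructure : UniformSpace BoundedPS :=
  UniformSpace.comap (fun f : BoundedPS => UniformOnFun.ofFun {K : Set ℂ | IsCompact K} f.eval)
    inferInstance

/-- The topology of `ℓ¹` convergence of the coefficients. -/
abbrev l1Topology : TopologicalSpace BoundedPS :=
  l1Structure.toMetricSpace.toPseudoMetricSpace.toUniformSpace.toTopologicalSpace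

/-- The topology of uniform convergence on the real line. -/
abbrev supTopology : TopologicalSpace BoundedPS :=
  supStructure.toMetricSpace.toPseudoMetricSpace.toUniformSpace.toTopologicalSpace

/-- The topology of uniform convergence on compact subsets of the complex plane. -/
abbrev compactTopology : TopologicalSpace BoundedPS := compactStructure.toTopologicalSpace

end BoundedPS

/-! ### The three ambient spaces -/

/-- The space of entire functions. As a subspace of `C(ℂ, ℂ)` it carries the uniform structure
of uniform convergence on compact subsets of `ℂ`. -/
def entireFunctions : Submodule ℂ C(ℂ, ℂ) where
  carrier := {g | Differentiable ℂ g}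
  zero_mem' := differentiable_const (0 : ℂ)
  add_mem' hf hg := Differentiable.add hf hg
  smul_mem' c _ hf := Differentiable.const_smul hf c

/-- The type of entire functions. -/
abbrev Entire : Type := entireFunctions

namespace BoundedPS

/-- A bounded power series as the sequence of its coefficients in `ℓ¹(ℕ, ℂ)`. -/
def toL1 : BoundedPS →ₗ[ℂ] lp (fun _ : ℕ => ℂ) 1 where
  toFun f := ⟨f.coeff, memℓp_gen (by simpa using f.summable_norm_coeff)⟩
  map_add' f g := by ext n; exact coeff_add f g n
  map_smul' c f := by ext n; exact coeff_smul c f n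

/-- A bounded power series as a bounded continuous function on the real line. -/
def toBCF : BoundedPS →ₗ[ℂ] (ℝ →ᵇ ℂ) where
  toFun f := BoundedContinuousFunction.ofNormedAddCommGroup (fun x : ℝ => f.eval x)
    (f.differentiable_eval.continuous.comp Complex.continuous_ofReal)
    f.eval_bounded.choose f.eval_bounded.choose_spec
  map_add' f g := by ext x; simp
  map_smul' c f := by ext x; simp

/-- A bounded power series as an entire function. -/
def toEntire : BoundedPS →ₗ[ℂ] Entire where
  toFun f := ⟨⟨f.eval, f.differentiable_eval.continuous⟩, f.differentiable_eval⟩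
  map_add' f g := by ext z; simp
  map_smul' c f := by ext z; simp

end BoundedPS

end

/-! The isometry and embedding claims are close to the definitions; the content is density and the
separation of the topologies. Write B for `BoundedPS`.

For `ℓ¹` and for compact convergence, the functions z^n exp(-d z²) with d > 0 lie in B and replace
the monomials, which do not for n ≥ 1. As d → 0 the coefficient sequence tends to the n-th unit
vector, at distance e^d - 1, and the function tends to z^n locally uniformly. Unit vectors span a
dense subspace of `ℓ¹`, and Taylor polynomials approximate every entire function.

For the supremum norm, density is Carleman's theorem with constant error (`exists_entire_approx`). A
continuous function on ℝ is cut into compactly supported pieces moving to infinity. Convolving a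
piece with a narrow Gaussian gives an entire function close to it on ℝ and tiny on a disc that grows
with the index, so the sum of these is entire. An entire function within ε of a bounded one on ℝ
lies in B.

Two sequences separate the topologies. As s → 0, s z exp(-s² z²) tends to 0 in `ℓ¹` and on compact
sets, but equals e⁻¹ at z = 1/s. The sequence (z/2)^k exp(-z²) tends to 0 in `ℓ¹` but is constant at
z = 2. -/

namespace BoundedPS

/-! ### Constructing members of B; Gaussian monomials -/

theorem exists_of_hasSum {c : ℕ → ℂ} {g : ℂ → ℂ} (h : ∀ z, HasSum (fun n => c n * z ^ n) (g z))
    {C : ℝ} (hC : ∀ x : ℝ, ‖g x‖ ≤ C) : ∃ F : BoundedPS, F.coeff = c ∧ F.eval = g := by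
  refine ⟨⟨PowerSeries.mk c, fun x => g x, fun x => ?_, C, hC⟩, ?_, ?_⟩
  · simpa using (h x).tendsto_sum_nat
  · ext n; simp [coeff]
  · ext z
    simpa [eval, coeff] using (h z).tsum_eq

theorem exists_eval_eq {g : ℂ → ℂ} (hg : Differentiable ℂ g) {C : ℝ}
    (hC : ∀ x : ℝ, ‖g x‖ ≤ C) : ∃ F : BoundedPS, F.eval = g := by
  obtain ⟨F, -, hF⟩ := exists_of_hasSum (c := fun n => (n.factorial : ℂ)⁻¹ * iteratedDeriv n g 0)
    (g := g) (fun z => by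
      simpa [mul_comm, mul_left_comm, mul_assoc] using Complex.hasSum_taylorSeries_of_entire hg 0 z)
    hC
  exact ⟨F, hF⟩

/-- The Taylor coefficients at `0` of `z ↦ z ^ n * exp (-(d * z ^ 2))`. -/
noncomputable def gaussianCoeff (n : ℕ) (d : ℝ) : ℕ → ℂ :=
  Function.extend (fun k : ℕ => n + 2 * k) (fun k => (-d : ℂ) ^ k / k.factorial) 0

theorem injective_add_two_mul (n : ℕ) : Function.Injective fun k : ℕ => n + 2 * k :=
  fun a b h => by simp only at h; omega

theorem gaussianCoeff_add (n : ℕ) (d : ℝ) (k : ℕ) :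
    gaussianCoeff n d (n + 2 * k) = (-d : ℂ) ^ k / k.factorial :=
  (injective_add_two_mul n).extend_apply _ _ _

theorem gaussianCoeff_eq_zero {n m : ℕ} (d : ℝ) (h : m ∉ Set.range fun k : ℕ => n + 2 * k) :
    gaussianCoeff n d m = 0 :=
  Function.extend_apply' _ _ _ h

theorem hasSum_gaussianCoeff (n : ℕ) (d : ℝ) (z : ℂ) :
    HasSum (fun m => gaussianCoeff n d m * z ^ m) (z ^ n * Complex.exp (-(d * z ^ 2))) := by
  rw [← (injective_add_two_mul n).hasSum_iff]
  · have h := (NormedSpace.expSeries_div_hasSum_exp (-(d * z ^ 2) : ℂ)).mul_left (z ^ n)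
    rw [← Complex.exp_eq_exp_ℂ] at h
    refine h.congr_fun fun k => ?_
    simp only [Function.comp_apply, gaussianCoeff_add, pow_add, pow_mul]
    rw [← neg_mul, mul_pow]
    ring
  · intro m hm
    rw [gaussianCoeff_eq_zero d hm, zero_mul]

theorem hasSum_norm_gaussianCoeff (n : ℕ) {d : ℝ} (hd : 0 ≤ d) :
    HasSum (fun m => ‖gaussianCoeff n d m‖) (Real.exp d) := by
  rw [← (injective_add_two_mul n).hasSum_iff]
  · have h := NormedSpace.expSeries_div_hasSum_exp d
    rw [← Real.exp_eq_exp_ℝ] at h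
    refine h.congr_fun fun k => ?_
    simp [gaussianCoeff_add, abs_of_nonneg hd]
  · intro m hm
    rw [gaussianCoeff_eq_zero d hm, norm_zero]

/-- The n-th coefficient is exactly 1, so subtracting the unit vector removes the leading term of
the series for e^d. -/
theorem hasSum_norm_gaussianCoeff_sub_single (n : ℕ) {d : ℝ} (hd : 0 ≤ d) :
    HasSum (fun m => ‖gaussianCoeff n d m - (Pi.single n 1 : ℕ → ℂ) m‖) (Real.exp d - 1) := by
  have h := (hasSum_norm_gaussianCoeff n hd).sub (hasSum_pi_single n (1 : ℝ))
  refine h.congr_fun fun m => ?_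
  rcases eq_or_ne m n with rfl | hm
  · have := gaussianCoeff_add m d 0
    simp only [mul_zero, add_zero, pow_zero, Nat.factorial_zero, Nat.cast_one, div_one] at this
    simp [this]
  · simp [hm]

/-- Combine |x|^n ≤ 1 + x^(2n) with (d x²)^n / n! ≤ exp(d x²), a single term of the exponential
series. -/
theorem norm_pow_mul_exp_le (n : ℕ) {d : ℝ} (hd : 0 < d) :
    ∃ C : ℝ, ∀ x : ℝ, ‖(x : ℂ) ^ n * Complex.exp (-(d * (x : ℂ) ^ 2))‖ ≤ C := by
  refine ⟨1 + n.factorial / d ^ n, fun x => ?_⟩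
  have he : ‖(x : ℂ) ^ n * Complex.exp (-(d * (x : ℂ) ^ 2))‖ = |x| ^ n / Real.exp (d * x ^ 2) := by
    rw [norm_mul, norm_pow, Complex.norm_real, Real.norm_eq_abs, Complex.norm_exp, div_eq_mul_inv,
      ← Real.exp_neg]
    congr 2
    norm_cast
  rw [he, div_le_iff₀ (Real.exp_pos _)]
  have h1 : 1 ≤ Real.exp (d * x ^ 2) := Real.one_le_exp (by positivity)
  have h2 := Real.pow_div_factorial_le_exp (d * x ^ 2) (by positivity) n
  have h3 : |x| ^ n ≤ 1 + (x ^ 2) ^ n := by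
    rw [← sq_abs, ← pow_mul, mul_comm 2 n, pow_mul]
    nlinarith [sq_nonneg (|x| ^ n - 1)]
  have h4 : (x ^ 2) ^ n ≤ n.factorial / d ^ n * Real.exp (d * x ^ 2) := by
    rw [div_le_iff₀ (by positivity), mul_pow] at h2
    rw [div_mul_eq_mul_div, le_div_iff₀ (by positivity)]
    linarith
  linarith

theorem exists_gaussianMonomial (n : ℕ) {d : ℝ} (hd : 0 < d) :
    ∃ F : BoundedPS, F.coeff = gaussianCoeff n d ∧
      F.eval = fun z => z ^ n * Complex.exp (-(d * z ^ 2)) :=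
  let ⟨_, hC⟩ := norm_pow_mul_exp_le n hd
  exists_of_hasSum (hasSum_gaussianCoeff n d) hC

/-- The function `z ↦ z ^ n * exp (-(d * z ^ 2))`, which is bounded on the real line if `0 < d`. -/
noncomputable def gaussianMonomial (n : ℕ) (d : Set.Ioi (0 : ℝ)) : BoundedPS :=
  (exists_gaussianMonomial n d.2).choose

theorem coeff_gaussianMonomial (n : ℕ) (d : Set.Ioi (0 : ℝ)) :
    (gaussianMonomial n d).coeff = gaussianCoeff n d :=
  (exists_gaussianMonomial n d.2).choose_spec.1

theorem eval_gaussianMonomial (n : ℕ) (d : Set.Ioi (0 : ℝ)) (z : ℂ) :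
    (gaussianMonomial n d).eval z = z ^ n * Complex.exp (-((d : ℝ) * z ^ 2)) :=
  congrFun (exists_gaussianMonomial n d.2).choose_spec.2 z

/-! ### Coefficient norm -/

theorem norm_lp_one (a : lp (fun _ : ℕ => ℂ) 1) : ‖a‖ = ∑' n, ‖a n‖ := by
  simp [lp.norm_eq_tsum_rpow (p := 1) (by simp) a]

theorem toL1_apply (f : BoundedPS) (n : ℕ) : toL1 f n = f.coeff n := rfl

theorem norm_toL1 (f : BoundedPS) : ‖toL1 f‖ = l1Norm f := norm_lp_one _

theorem isometry_toL1 : letI := l1Structure; Isometry toL1 := by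
  let _ := l1Structure
  exact AddMonoidHomClass.isometry_of_norm toL1.toAddMonoidHom norm_toL1

theorem norm_toL1_gaussianMonomial (n : ℕ) (d : Set.Ioi (0 : ℝ)) :
    ‖toL1 (gaussianMonomial n d)‖ = Real.exp d := by
  rw [norm_lp_one, ← (hasSum_norm_gaussianCoeff n d.2.le).tsum_eq]
  simp [toL1_apply, coeff_gaussianMonomial]

theorem norm_toL1_gaussianMonomial_sub_single (n : ℕ) (d : Set.Ioi (0 : ℝ)) :
    ‖toL1 (gaussianMonomial n d) - lp.single 1 n 1‖ = Real.exp d - 1 := by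
  rw [norm_lp_one, ← (hasSum_norm_gaussianCoeff_sub_single n d.2.le).tsum_eq]
  simp [toL1_apply, coeff_gaussianMonomial]

/-- Makes limits d → 0 usable along the subtype d > 0, the only range where the Gaussian monomials
are defined in B. -/
instance neBot_comap_nhds_zero : (comap ((↑) : Set.Ioi (0 : ℝ) → ℝ) (𝓝 0)).NeBot := by
  rw [← mem_closure_iff_comap_neBot, closure_Ioi]
  exact Set.self_mem_Ici

theorem denseRange_toL1 : DenseRange toL1 := by
  have hsingle (n : ℕ) : lp.single 1 n (1 : ℂ) ∈ (LinearMap.range toL1).topologicalClosure := by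
    refine mem_closure_of_tendsto (f := fun d => toL1 (gaussianMonomial n d))
      (b := comap ((↑) : Set.Ioi (0 : ℝ) → ℝ) (𝓝 0)) ?_ (Eventually.of_forall fun d => ⟨_, rfl⟩)
    rw [tendsto_iff_norm_sub_tendsto_zero]
    simp only [norm_toL1_gaussianMonomial_sub_single]
    have : Tendsto (fun d : ℝ => Real.exp d - 1) (𝓝 0) (𝓝 0) := by
      have h : Continuous fun d : ℝ => Real.exp d - 1 := by fun_prop
      simpa using h.tendsto 0
    exact this.comp tendsto_comap
  intro a
  refine (LinearMap.range toL1).isClosed_topologicalClosure.mem_of_tendsto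
    (lp.hasSum_single ENNReal.one_ne_top a) (Eventually.of_forall fun s => ?_)
  refine Submodule.sum_mem _ fun n _ => ?_
  have := Submodule.smul_mem _ (a n) (hsingle n)
  rwa [← lp.single_smul, smul_eq_mul, mul_one] at this

/-! ### Entire functions -/

theorem isUniformEmbedding_toEntire :
    letI := compactStructure; IsUniformEmbedding toEntire := by
  let _ := compactStructure
  refine ⟨?_, fun f g h => ?_⟩
  · have h1 : IsUniformInducing fun f : BoundedPS =>
        UniformOnFun.ofFun {K : Set ℂ | IsCompact K} f.eval := ⟨rfl⟩
    have h2 : IsUniformInducing fun g : Entire => (g : C(ℂ, ℂ)).toUniformOnFunIsCompact :=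
      ContinuousMap.isUniformEmbedding_toUniformOnFunIsCompact.isUniformInducing.comp
        isUniformEmbedding_subtype_val.isUniformInducing
    exact (h2.of_comp_iff (f := toEntire)).1 h1
  · have h0 : ∀ z, f.eval z = g.eval z := fun z =>
      DFunLike.congr_fun (congrArg (Subtype.val : Entire → C(ℂ, ℂ)) h) z
    rw [← sub_eq_zero]
    refine eq_zero_of_eval_real _ fun x => ?_
    rw [sub_eq_add_neg, eval_add, eval_neg, h0, add_neg_cancel]

/-- Weierstrass: locally uniform limits of holomorphic functions are holomorphic. -/
theorem isClosed_entireFunctions : IsClosed (entireFunctions : Set C(ℂ, ℂ)) := by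
  refine isClosed_of_closure_subset fun g hg => ?_
  obtain ⟨u, hu, hug⟩ := mem_closure_iff_ultrafilter.1 hg
  have h := ContinuousMap.tendsto_iff_tendstoLocallyUniformly.1
    (show Tendsto id (u : Filter _) (𝓝 g) from hug)
  have h2 := (tendstoLocallyUniformlyOn_univ.2 h).differentiableOn
    (by filter_upwards [hu] with k hk using hk.differentiableOn) isOpen_univ
  exact differentiableOn_univ.1 h2

theorem completeSpace_entire : CompleteSpace Entire :=
  isClosed_entireFunctions.completeSpace_coe

/-- The function `z ↦ a * z ^ n * exp (-(d * z ^ 2))`, continuously depending on `(a, d)`. -/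
noncomputable def scaledGaussian (n : ℕ) : C(ℂ × ℝ, C(ℂ, ℂ)) :=
  ContinuousMap.curry
    ⟨fun p : (ℂ × ℝ) × ℂ => p.1.1 * (p.2 ^ n * Complex.exp (-(p.1.2 * p.2 ^ 2))), by fun_prop⟩

theorem coe_toEntire_smul_gaussianMonomial (a : ℂ) (n : ℕ) (d : Set.Ioi (0 : ℝ)) :
    (toEntire (a • gaussianMonomial n d) : C(ℂ, ℂ)) = scaledGaussian n (a, d) := by
  ext z
  change eval _ z = _
  rw [eval_smul, eval_gaussianMonomial]
  rfl

theorem denseRange_toEntire : DenseRange toEntire := by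
  let S : Submodule ℂ C(ℂ, ℂ) :=
    (LinearMap.range (entireFunctions.subtype ∘ₗ toEntire)).topologicalClosure
  have hmon (n : ℕ) (a : ℂ) : scaledGaussian n (a, 0) ∈ S := by
    refine mem_closure_of_tendsto (f := fun d => (toEntire (a • gaussianMonomial n d) : C(ℂ, ℂ)))
      (b := comap ((↑) : Set.Ioi (0 : ℝ) → ℝ) (𝓝 0)) ?_ (Eventually.of_forall fun d => ⟨_, rfl⟩)
    simp only [coe_toEntire_smul_gaussianMonomial]
    -- Continuity of the curried map into `C(ℂ, ℂ)` encodes locally uniform convergence, and it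
    -- includes d = 0, where the function is a z^n.
    have h : Continuous fun d : ℝ => scaledGaussian n (a, d) := by fun_prop
    exact (h.tendsto 0).comp tendsto_comap
  intro g
  rw [IsInducing.subtypeVal.closure_eq_preimage_closure_image, Set.mem_preimage]
  have hS : (g : C(ℂ, ℂ)) ∈ S := by
    obtain ⟨p, hp⟩ : ∃ p, HasFPowerSeriesOnBall (g : C(ℂ, ℂ)) p 0 ∞ :=
      ⟨_, Differentiable.hasFPowerSeriesOnBall g.2 0 (R := 1) one_pos⟩
    refine (Submodule.isClosed_topologicalClosure _).mem_of_tendsto (b := atTop)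
      (f := fun N => ∑ k ∈ Finset.range N, scaledGaussian k (p.coeff k, 0)) ?_
      (Eventually.of_forall fun N => Submodule.sum_mem _ fun k _ => hmon k _)
    rw [ContinuousMap.tendsto_iff_tendstoLocallyUniformly, ← tendstoLocallyUniformlyOn_univ]
    have h := hp.tendstoLocallyUniformlyOn'
    rw [Metric.eball_top] at h
    refine h.congr fun N z _ => ?_
    simp [FormalMultilinearSeries.partialSum, scaledGaussian, mul_comm]
  rw [← Set.range_comp]
  exact hS

/-! ### Supremum norm -/

theorem isometry_toBCF : letI := supStructure; Isometry toBCF := by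
  let _ := supStructure
  refine AddMonoidHomClass.isometry_of_norm toBCF.toAddMonoidHom fun f => ?_
  exact BoundedContinuousFunction.norm_eq_iSup_norm (toBCF f)

/-! ### Comparison of the topologies -/

theorem l1Topology_eq_induced : l1Topology = TopologicalSpace.induced toL1 inferInstance :=
  letI := l1Structure
  isometry_toL1.isUniformInducing.isInducing.eq_induced

theorem supTopology_eq_induced : supTopology = TopologicalSpace.induced toBCF inferInstance :=
  letI := supStructure
  isometry_toBCF.isUniformInducing.isInducing.eq_induced

theorem compactTopology_eq_induced :
    compactTopology = TopologicalSpace.induced toEntire inferInstance :=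
  letI := compactStructure
  isUniformEmbedding_toEntire.isUniformInducing.isInducing.eq_induced

/-- A null sequence for the `ℓ¹` norm and for compact convergence, but not for the supremum norm. -/
noncomputable def spreadingGaussian (k : ℕ) : BoundedPS :=
  ((1 / ((k : ℝ) + 1) : ℝ) : ℂ) • gaussianMonomial 1 ⟨(1 / ((k : ℝ) + 1)) ^ 2, by
    rw [Set.mem_Ioi]; positivity⟩

theorem tendsto_toL1_spreadingGaussian :
    Tendsto (fun k => toL1 (spreadingGaussian k)) atTop (𝓝 0) := by
  rw [tendsto_zero_iff_norm_tendsto_zero]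
  have h : Continuous fun s : ℝ => |s| * Real.exp (s ^ 2) := by fun_prop
  have h2 := (h.tendsto 0).comp (tendsto_one_div_add_atTop_nhds_zero_nat (𝕜 := ℝ))
  rw [abs_zero, zero_mul] at h2
  refine h2.congr fun k => ?_
  rw [spreadingGaussian, map_smul, norm_smul, norm_toL1_gaussianMonomial, Complex.norm_real]
  rfl

theorem tendsto_toEntire_spreadingGaussian :
    Tendsto (fun k => toEntire (spreadingGaussian k)) atTop (𝓝 0) := by
  rw [IsInducing.subtypeVal.tendsto_nhds_iff]
  have h : Continuous fun s : ℝ => scaledGaussian 1 ((s : ℂ), s ^ 2) := by fun_prop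
  have h2 := (h.tendsto 0).comp (tendsto_one_div_add_atTop_nhds_zero_nat (𝕜 := ℝ))
  have h0 : scaledGaussian 1 (((0 : ℝ) : ℂ), 0 ^ 2) = 0 := by
    ext z
    simp [scaledGaussian]
  rw [h0] at h2
  refine h2.congr fun k => ?_
  rw [Function.comp_apply, Function.comp_apply, spreadingGaussian,
    coe_toEntire_smul_gaussianMonomial]

theorem not_tendsto_toBCF_spreadingGaussian :
    ¬ Tendsto (fun k => toBCF (spreadingGaussian k)) atTop (𝓝 0) := by
  intro h
  have h1 := tendsto_zero_iff_norm_tendsto_zero.1 h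
  refine (Real.exp_pos (-1)).not_ge (ge_of_tendsto' h1 fun k => ?_)
  -- With s = 1/(k+1), evaluate at 1/s, where s z = 1.
  have h2 := (toBCF (spreadingGaussian k)).norm_coe_le_norm ((k : ℝ) + 1)
  have h3 : toBCF (spreadingGaussian k) ((k : ℝ) + 1) = Complex.exp (-1) := by
    change eval _ _ = _
    have hk : (k : ℂ) + 1 ≠ 0 := by exact_mod_cast k.succ_ne_zero
    rw [spreadingGaussian, eval_smul, eval_gaussianMonomial]
    push_cast
    field_simp
  rw [h3, Complex.norm_exp] at h2
  simpa using h2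

/-- A null sequence for the `ℓ¹` norm which is constant at the point `2`. -/
noncomputable def escapingGaussian (k : ℕ) : BoundedPS :=
  ((1 / 2 : ℂ) ^ k) • gaussianMonomial k ⟨1, Set.mem_Ioi.2 one_pos⟩

theorem tendsto_toL1_escapingGaussian :
    Tendsto (fun k => toL1 (escapingGaussian k)) atTop (𝓝 0) := by
  rw [tendsto_zero_iff_norm_tendsto_zero]
  have h := (tendsto_pow_atTop_nhds_zero_of_lt_one (r := (1 / 2 : ℝ)) (by norm_num)
    (by norm_num)).mul_const (Real.exp 1)
  rw [zero_mul] at h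
  refine h.congr fun k => ?_
  rw [escapingGaussian, map_smul, norm_smul, norm_toL1_gaussianMonomial]
  simp

theorem not_tendsto_toEntire_escapingGaussian :
    ¬ Tendsto (fun k => toEntire (escapingGaussian k)) atTop (𝓝 0) := by
  intro h
  have hc : Continuous fun g : Entire => (g : C(ℂ, ℂ)) 2 := by fun_prop
  have h1 := (hc.tendsto 0).comp h
  have h2 : ∀ k, (toEntire (escapingGaussian k) : C(ℂ, ℂ)) 2 = Complex.exp (-4) := fun k => by
    change eval _ _ = _
    rw [escapingGaussian, eval_smul, eval_gaussianMonomial, ← mul_assoc, ← mul_pow]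
    norm_num
  have h3 := tendsto_nhds_unique (h1.congr h2) tendsto_const_nhds
  exact Complex.exp_ne_zero _ h3.symm

theorem ne_of_tendsto_of_not_tendsto {X Y Z : Type*} [s : TopologicalSpace Y]
    [t : TopologicalSpace Z] {f : X → Y} {g : X → Z} {u : ℕ → X} {x : X}
    (hf : Tendsto (fun k => f (u k)) atTop (𝓝 (f x)))
    (hg : ¬ Tendsto (fun k => g (u k)) atTop (𝓝 (g x))) :
    TopologicalSpace.induced f s ≠ TopologicalSpace.induced g t := by
  intro h
  have h1 : Tendsto u atTop (@nhds _ (TopologicalSpace.induced f s) x) := by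
    rw [nhds_induced, tendsto_comap_iff]
    exact hf
  rw [h, nhds_induced, tendsto_comap_iff] at h1
  exact hg h1

theorem l1Topology_ne_supTopology : l1Topology ≠ supTopology := by
  rw [l1Topology_eq_induced, supTopology_eq_induced]
  refine ne_of_tendsto_of_not_tendsto (u := spreadingGaussian) (x := 0) ?_ ?_
  · rw [map_zero]
    exact tendsto_toL1_spreadingGaussian
  · rw [map_zero]
    exact not_tendsto_toBCF_spreadingGaussian

theorem l1Topology_ne_compactTopology : l1Topology ≠ compactTopology := by
  rw [l1Topology_eq_induced, compactTopology_eq_induced]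
  refine ne_of_tendsto_of_not_tendsto (u := escapingGaussian) (x := 0) ?_ ?_
  · rw [map_zero]
    exact tendsto_toL1_escapingGaussian
  · rw [map_zero]
    exact not_tendsto_toEntire_escapingGaussian

theorem supTopology_ne_compactTopology : supTopology ≠ compactTopology := by
  rw [supTopology_eq_induced, compactTopology_eq_induced]
  refine (ne_of_tendsto_of_not_tendsto (u := spreadingGaussian) (x := 0) ?_ ?_).symm
  · rw [map_zero]
    exact tendsto_toEntire_spreadingGaussian
  · rw [map_zero]
    exact not_tendsto_toBCF_spreadingGaussian

end BoundedPS

/-! ### Gaussian smoothing and Carleman approximation -/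

open MeasureTheory ProbabilityTheory in
/-- Smoothing a bounded function by a Gaussian of variance `v`. -/
theorem norm_integral_gaussianReal_sub_le {f : ℝ → ℂ} (hf : Continuous f) {M ε K : ℝ}
    (hM : ∀ t, ‖f t‖ ≤ M) {x : ℝ} (h : ∀ t, ‖f t - f x‖ ≤ ε + K * (t - x) ^ 2)
    (v : NNReal) : ‖∫ t, f t ∂(gaussianReal x v) - f x‖ ≤ ε + K * v := by
  have hi : Integrable f (gaussianReal x v) :=
    Integrable.of_bound hf.aestronglyMeasurable M (Eventually.of_forall hM)
  have hsq : Integrable (fun t : ℝ => (t - x) ^ 2) (gaussianReal x v) := by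
    have := ((memLp_id_gaussianReal (μ := x) (v := v) 2).sub (memLp_const x)).integrable_sq
    simpa using this
  have hvar : ∫ t, (t - x) ^ 2 ∂(gaussianReal x v) = v := by
    have h1 := variance_eq_integral (μ := gaussianReal x v) (X := id) measurable_id.aemeasurable
    rw [variance_id_gaussianReal] at h1
    simpa using h1.symm
  have h1 : ∫ t, f t ∂(gaussianReal x v) - f x = ∫ t, (f t - f x) ∂(gaussianReal x v) := by
    rw [integral_sub hi (integrable_const _)]
    simp
  rw [h1]
  refine (norm_integral_le_of_norm_le ((integrable_const ε).add (hsq.const_mul K))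
    (Eventually.of_forall h)).trans_eq ?_
  simp only [Pi.add_apply]
  rw [integral_add (integrable_const ε) (hsq.const_mul K), integral_const_mul, hvar]
  simp

/-- Uniform continuity handles |t - x| < δ; beyond δ the trivial bound 2M is at most (2M/δ²)(t -
x)². The quadratic form is chosen because its Gaussian mean is the variance. -/
theorem UniformContinuous.exists_norm_sub_le_add_mul_sq {f : ℝ → ℂ} (hf : UniformContinuous f)
    {M ε : ℝ} (hM : ∀ t, ‖f t‖ ≤ M) (hε : 0 < ε) :
    ∃ K : ℝ, 0 ≤ K ∧ ∀ t x, ‖f t - f x‖ ≤ ε + K * (t - x) ^ 2 := by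
  obtain ⟨δ, hδ, h⟩ := Metric.uniformContinuous_iff.1 hf ε hε
  have hM0 : 0 ≤ M := (norm_nonneg _).trans (hM 0)
  refine ⟨2 * M / δ ^ 2, by positivity, fun t x => ?_⟩
  rcases lt_or_ge (dist t x) δ with htx | htx
  · have := (h htx).le
    rw [dist_eq_norm] at this
    have : 0 ≤ 2 * M / δ ^ 2 * (t - x) ^ 2 := by positivity
    linarith
  · have h1 : ‖f t - f x‖ ≤ 2 * M := (norm_sub_le _ _).trans (by linarith [hM t, hM x])
    have h2 : δ ^ 2 ≤ (t - x) ^ 2 := by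
      rw [← sq_abs (t - x), ← Real.dist_eq]
      exact pow_le_pow_left₀ hδ.le htx 2
    have h3 : 2 * M ≤ 2 * M / δ ^ 2 * (t - x) ^ 2 := by
      rw [div_mul_eq_mul_div, le_div_iff₀ (by positivity)]
      exact mul_le_mul_of_nonneg_left h2 (by positivity)
    linarith

-- Differentiation under the integral: near z the derivative is dominated by its maximum on a
-- compact product.
open MeasureTheory in
theorem differentiable_intervalIntegral_of_continuous_deriv {F F' : ℂ → ℝ → ℂ} {a b : ℝ}
    (hF : ∀ z, Continuous (F z)) (hF' : Continuous (Function.uncurry F'))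
    (h : ∀ z t, HasDerivAt (F · t) (F' z t) z) : Differentiable ℂ fun z => ∫ t in a..b, F z t := by
  intro z
  obtain ⟨C, hC⟩ := ((isCompact_closedBall z 1).prod 
    (isCompact_uIcc (a := a) (b := b))).exists_bound_of_continuousOn
    hF'.continuousOn
  refine (intervalIntegral.hasDerivAt_integral_of_dominated_loc_of_deriv_le
    (bound := fun _ => C) (Metric.closedBall_mem_nhds z one_pos)
    (Eventually.of_forall fun w => (hF w).aestronglyMeasurable) ((hF z).intervalIntegrable a b)
    (F' := F') (hF'.comp (Continuous.prodMk_right z)).aestronglyMeasurable ?_ (by simp)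
    (Eventually.of_forall fun t _ w _ => h w t)).2.differentiableAt
  exact Eventually.of_forall fun t ht w hw => hC (w, t) ⟨hw, Set.uIoc_subset_uIcc ht⟩

/-- The convolution of `f` with the Gaussian density of standard deviation `s`, extended to `ℂ`. -/
noncomputable def gaussianSmoothing (f : ℝ → ℂ) (a b s : ℝ) (z : ℂ) : ℂ :=
  ∫ t in a..b, ((√(2 * Real.pi * s ^ 2))⁻¹ : ℝ) * Complex.exp (-(t - z) ^ 2 / (2 * s ^ 2)) * f t

theorem differentiable_gaussianSmoothing {f : ℝ → ℂ} (hf : Continuous f) (a b s : ℝ) :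
    Differentiable ℂ (gaussianSmoothing f a b s) := by
  refine differentiable_intervalIntegral_of_continuous_deriv
    (F' := fun z t => ((√(2 * Real.pi * s ^ 2))⁻¹ : ℝ) *
      (Complex.exp (-(t - z) ^ 2 / (2 * s ^ 2)) * ((2 * (t - z)) / (2 * s ^ 2))) * f t)
    (fun z => by fun_prop) (by unfold Function.uncurry; fun_prop) fun z t => ?_
  refine ((HasDerivAt.cexp ?_).const_mul _).mul_const _
  have := ((((hasDerivAt_id z).const_sub (t : ℂ)).pow 2).neg).div_const (2 * (s : ℂ) ^ 2)
  refine this.congr_deriv ?_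
  simp

open MeasureTheory ProbabilityTheory in
theorem gaussianSmoothing_ofReal {f : ℝ → ℂ} {a b : ℝ} (hf : Function.support f ⊆ Set.Ioc a b)
    {s : ℝ} (hs : 0 < s) (x : ℝ) :
    gaussianSmoothing f a b s x = ∫ t, f t ∂(gaussianReal x (.mk (s ^ 2) (sq_nonneg s))) := by
  rw [integral_gaussianReal_eq_integral_smul (by
    rw [ne_eq, ← NNReal.coe_eq_zero]; exact (pow_pos hs 2).ne'), gaussianSmoothing,
    intervalIntegral.integral_eq_integral_of_support_subset]
  · refine integral_congr_ae (Eventually.of_forall fun t => ?_)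
    simp [gaussianPDFReal, Complex.real_smul]
  · exact (Function.support_mul_subset_right _ _).trans hf

/-- The kernel has modulus governed by (t - Re z)² - (Im z)², which is at least (r+1)² - r² ≥ 1 on
the support of f. Hence the exponential is at most 2s², which beats the normalisation 1/s. -/
theorem norm_gaussianSmoothing_le {f : ℝ → ℂ} {M a b r s : ℝ} (hM : ∀ t, ‖f t‖ ≤ M)
    (hf : ∀ t, f t ≠ 0 → 2 * r + 1 ≤ |t|) (hs : 0 < s) {z : ℂ} (hz : ‖z‖ ≤ r) :
    ‖gaussianSmoothing f a b s z‖ ≤ 2 * M * |b - a| * s := by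
  have hM0 : 0 ≤ M := (norm_nonneg _).trans (hM 0)
  have hr : 0 ≤ r := (norm_nonneg z).trans hz
  refine (intervalIntegral.norm_integral_le_of_norm_le_const (C := 2 * M * s) fun t _ => ?_).trans_eq
    (by ring)
  rcases eq_or_ne (f t) 0 with h0 | h0
  · rw [h0, mul_zero, norm_zero]
    positivity
  have h1 : 1 ≤ (t - z.re) ^ 2 - z.im ^ 2 := by
    have ht := hf t h0
    have hre := (Complex.abs_re_le_norm z).trans hz
    have him := (Complex.abs_im_le_norm z).trans hz
    have h2 : r + 1 ≤ |t - z.re| := by linarith [abs_sub_abs_le_abs_sub t z.re]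
    rw [← sq_abs (t - z.re), ← sq_abs z.im]
    nlinarith [abs_nonneg z.im, abs_nonneg (t - z.re)]
  have hexp : ‖Complex.exp (-(t - z) ^ 2 / (2 * s ^ 2))‖ ≤ 2 * s ^ 2 := by
    have h3 : (-((t : ℂ) - z) ^ 2 / (2 * (s : ℂ) ^ 2)).re =
        -((t - z.re) ^ 2 - z.im ^ 2) / (2 * s ^ 2) := by
      rw [show (2 * (s : ℂ) ^ 2) = ((2 * s ^ 2 : ℝ) : ℂ) by push_cast; rfl, Complex.div_ofReal_re]
      simp [pow_two]
    rw [Complex.norm_exp, h3, neg_div, Real.exp_neg]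
    refine inv_le_of_inv_le₀ (by positivity) ?_
    have h4 : (2 * s ^ 2)⁻¹ ≤ ((t - z.re) ^ 2 - z.im ^ 2) / (2 * s ^ 2) := by
      rw [inv_eq_one_div]
      gcongr
    linarith [Real.add_one_le_exp (((t - z.re) ^ 2 - z.im ^ 2) / (2 * s ^ 2))]
  have hsqrt : (√(2 * Real.pi * s ^ 2))⁻¹ ≤ s⁻¹ := by
    refine inv_anti₀ hs (Real.le_sqrt_of_sq_le ?_)
    nlinarith [Real.pi_gt_three, pow_pos hs 2]
  rw [norm_mul, norm_mul, Complex.norm_real, Real.norm_of_nonneg (by positivity)]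
  calc _ ≤ s⁻¹ * (2 * s ^ 2) * M := by
        gcongr
        exact hM t
    _ = 2 * M * s := by field_simp

/-- A continuous function supported in an annulus is approximated on the real line by entire
functions that are small on a disc inside the annulus. -/
theorem exists_entire_approx_of_support {f : ℝ → ℂ} (hf : Continuous f) {a b r : ℝ}
    (hsupp : Function.support f ⊆ Set.Ioc a b) (hr : ∀ t, f t ≠ 0 → 2 * r + 1 ≤ |t|) {ε : ℝ}
    (hε : 0 < ε) :
    ∃ g : ℂ → ℂ, Differentiable ℂ g ∧ (∀ x : ℝ, ‖g x - f x‖ ≤ ε) ∧ ∀ z, ‖z‖ ≤ r → ‖g z‖ ≤ ε := by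
  have hcs : HasCompactSupport f := HasCompactSupport.of_support_subset_isCompact isCompact_Icc
    (hsupp.trans Set.Ioc_subset_Icc_self)
  obtain ⟨M, hM⟩ := hf.bounded_above_of_compact_support hcs
  obtain ⟨K, hK, h⟩ := (hcs.uniformContinuous_of_continuous hf).exists_norm_sub_le_add_mul_sq
    hM (half_pos hε)
  have hlim {φ : ℝ → ℝ} (hφ : Continuous φ) (h0 : φ 0 = 0) {η : ℝ} (hη : 0 < η) :
      ∀ᶠ s in 𝓝[>] (0 : ℝ), φ s < η :=
    ((hφ.tendsto' 0 0 h0).mono_left nhdsWithin_le_nhds).eventually_lt_const hη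
  obtain ⟨s, hs1, hs2, hs⟩ := ((hlim (φ := fun s => K * s ^ 2) (by fun_prop) (by simp)
    (half_pos hε)).and ((hlim (φ := fun s => 2 * M * |b - a| * s) (by fun_prop) (by simp) hε).and
    self_mem_nhdsWithin)).exists
  refine ⟨gaussianSmoothing f a b s, differentiable_gaussianSmoothing hf a b s, fun x => ?_,
    fun z hz => (norm_gaussianSmoothing_le hM hr hs hz).trans hs2.le⟩
  rw [gaussianSmoothing_ofReal hsupp hs]
  refine (norm_integral_gaussianReal_sub_le hf hM (fun t => h t x) _).trans ?_
  change ε / 2 + K * s ^ 2 ≤ ε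
  linarith

/-- A continuous cutoff, equal to `1` for `|x| ≤ n - 1` and to `0` for `n ≤ |x|`. -/
noncomputable def cutoff (n : ℕ) (x : ℝ) : ℝ := max 0 (min 1 (n - |x|))

theorem continuous_cutoff (n : ℕ) : Continuous (cutoff n) := by
  unfold cutoff
  fun_prop

theorem cutoff_zero (x : ℝ) : cutoff 0 x = 0 := by
  have := abs_nonneg x
  rw [cutoff, max_eq_left]
  refine (min_le_right _ _).trans ?_
  simp

theorem cutoff_eq_one {n : ℕ} {x : ℝ} (h : |x| + 1 ≤ n) : cutoff n x = 1 := by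
  rw [cutoff, min_eq_left (by linarith), max_eq_right zero_le_one]

theorem cutoff_eq_zero {n : ℕ} {x : ℝ} (h : n ≤ |x|) : cutoff n x = 0 := by
  rw [cutoff, max_eq_left ((min_le_right _ _).trans (by linarith))]

/-- At each x only finitely many terms are nonzero, and the sum telescopes. -/
theorem hasSum_cutoff_sub (f : ℝ → ℂ) (x : ℝ) :
    HasSum (fun n : ℕ => ((cutoff (n + 1) x - cutoff n x : ℝ) : ℂ) * f x) (f x) := by
  obtain ⟨N, hN⟩ := exists_nat_ge (|x| + 1)
  have h0 : ∀ n ∉ Finset.range N, ((cutoff (n + 1) x - cutoff n x : ℝ) : ℂ) * f x = 0 := by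
    intro n hn
    have hn' : (N : ℝ) ≤ n := by exact_mod_cast not_lt.1 (mt Finset.mem_range.2 hn)
    rw [cutoff_eq_one (by push_cast; linarith), cutoff_eq_one (hN.trans hn')]
    simp
  have h1 : HasSum _ _ := hasSum_sum_of_ne_finset_zero h0
  rwa [← Finset.sum_mul, ← Complex.ofReal_sum, Finset.sum_range_sub (fun n => cutoff n x),
    cutoff_eq_one hN, cutoff_zero, sub_zero, Complex.ofReal_one, one_mul] at h1

/-- **Carleman's approximation theorem** with a constant error. -/
theorem exists_entire_approx {f : ℝ → ℂ} (hf : Continuous f) {ε : ℝ} (hε : 0 < ε) :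
    ∃ g : ℂ → ℂ, Differentiable ℂ g ∧ ∀ x : ℝ, ‖g x - f x‖ ≤ ε := by
  -- The n-th piece vanishes for |x| ≤ n - 1, and the radius solves 2r + 1 = n - 1. The errors
  -- ε/2/2^n sum to ε.
  have key (n : ℕ) : ∃ g : ℂ → ℂ, Differentiable ℂ g ∧
      (∀ x : ℝ, ‖g x - ((cutoff (n + 1) x - cutoff n x : ℝ) : ℂ) * f x‖ ≤ ε / 2 / 2 ^ n) ∧
      ∀ z, ‖z‖ ≤ ((n : ℝ) - 2) / 2 → ‖g z‖ ≤ ε / 2 / 2 ^ n := by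
    refine exists_entire_approx_of_support (a := -(n + 2)) (b := n + 2) ?_ (fun t ht => ?_)
      (fun t ht => ?_) (by positivity)
    · exact (Complex.continuous_ofReal.comp
        ((continuous_cutoff _).sub (continuous_cutoff _))).mul hf
    · by_contra hn
      have h1 : (n : ℝ) + 1 ≤ |t| := by
        by_contra h2
        obtain ⟨h3, h4⟩ := abs_lt.1 (not_le.1 h2)
        exact hn ⟨by linarith, by linarith⟩
      refine ht ?_
      simp only
      rw [cutoff_eq_zero (by push_cast; exact h1), cutoff_eq_zero (by linarith)]
      simp
    · by_contra hn
      refine ht ?_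
      rw [cutoff_eq_one (by push_cast; linarith), cutoff_eq_one (by linarith)]
      simp
  choose g hg happrox hsmall using key
  have hgeom := hasSum_geometric_two' ε
  refine ⟨fun z => ∑' n, g n z, fun z => ?_, fun x => ?_⟩
  -- From index N on, the discs of smallness contain the ball of radius ‖z‖ + 1, so the Weierstrass
  -- M-test applies to the tail.
  · obtain ⟨N, hN⟩ := exists_nat_ge (2 * (‖z‖ + 1) + 2)
    have hball : DifferentiableOn ℂ (fun w => ∑' n, g (n + N) w) (Metric.ball 0 (‖z‖ + 1)) := by
      refine Complex.differentiableOn_tsum_of_summable_norm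
        ((summable_nat_add_iff N).2 hgeom.summable)
        (fun n => (hg _).differentiableOn) Metric.isOpen_ball fun n w hw => hsmall _ _ ?_
      have := mem_ball_zero_iff.1 hw
      push_cast
      linarith [(Nat.cast_nonneg n : (0 : ℝ) ≤ n)]
    have hsum : DifferentiableOn ℂ (fun w => ∑ n ∈ Finset.range N, g n w + ∑' n, g (n + N) w)
        (Metric.ball 0 (‖z‖ + 1)) :=
      (DifferentiableOn.fun_sum fun n _ => (hg n).differentiableOn).add hball
    have hz : Metric.ball (0 : ℂ) (‖z‖ + 1) ∈ 𝓝 z :=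
      Metric.isOpen_ball.mem_nhds (by simp)
    refine (hsum.differentiableAt hz).congr_of_eventuallyEq ?_
    filter_upwards [hz] with w hw
    refine (Summable.sum_add_tsum_nat_add N ?_).symm
    refine (summable_nat_add_iff N).1 (Summable.of_norm_bounded
      ((summable_nat_add_iff N).2 hgeom.summable) fun n => hsmall _ _ ?_)
    have := mem_ball_zero_iff.1 hw
    push_cast
    linarith [(Nat.cast_nonneg n : (0 : ℝ) ≤ n)]
  · have hd := Summable.of_norm_bounded hgeom.summable (fun n => happrox n x)
    have h1 := (hd.hasSum.add (hasSum_cutoff_sub f x)).tsum_eq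
    simp only [sub_add_cancel] at h1
    change ‖∑' n, g n x - f x‖ ≤ ε
    rw [h1, add_sub_cancel_right]
    exact tsum_of_norm_bounded hgeom fun n => happrox n x

namespace BoundedPS

theorem denseRange_toBCF : DenseRange toBCF := by
  refine Metric.dense_iff.2 fun f ε hε => ?_
  obtain ⟨g, hg, hgf⟩ := exists_entire_approx f.continuous (half_pos hε)
  obtain ⟨F, hF⟩ := exists_eval_eq hg (C := ‖f‖ + ε / 2) fun x => by
    have h1 := hgf x
    have h2 := f.norm_coe_le_norm x
    have h3 := norm_le_norm_add_norm_sub' (g x) (f x)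
    linarith
  refine ⟨toBCF F, ?_, F, rfl⟩
  rw [Metric.mem_ball]
  refine lt_of_le_of_lt ((BoundedContinuousFunction.dist_le (half_pos hε).le).2 fun x => ?_)
    (half_lt_self hε)
  rw [dist_eq_norm]
  change ‖F.eval x - f x‖ ≤ _
  rw [hF]
  exact hgf x

end BoundedPS

theorem theorem2 :
    -- (i) the coefficient norm
    ((letI := BoundedPS.l1Structure; Isometry BoundedPS.toL1) ∧
      DenseRange BoundedPS.toL1 ∧ CompleteSpace (lp (fun _ : ℕ => ℂ) 1)) ∧
    -- (ii) the supremum norm on the real line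
    ((letI := BoundedPS.supStructure; Isometry BoundedPS.toBCF) ∧
      DenseRange BoundedPS.toBCF ∧ CompleteSpace (ℝ →ᵇ ℂ)) ∧
    -- (iii) uniform convergence on compact subsets of the complex plane
    ((letI := BoundedPS.compactStructure; IsUniformEmbedding BoundedPS.toEntire) ∧
      DenseRange BoundedPS.toEntire ∧ CompleteSpace Entire) ∧
    -- the three topologies are pairwise different
    BoundedPS.l1Topology ≠ BoundedPS.supTopology ∧
    BoundedPS.l1Topology ≠ BoundedPS.compactTopology ∧
    BoundedPS.supTopology ≠ BoundedPS.compactTopology := by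
  exact ⟨⟨BoundedPS.isometry_toL1, BoundedPS.denseRange_toL1, inferInstance⟩,
    ⟨BoundedPS.isometry_toBCF, BoundedPS.denseRange_toBCF, inferInstance⟩,
    ⟨BoundedPS.isUniformEmbedding_toEntire, BoundedPS.denseRange_toEntire,
      BoundedPS.completeSpace_entire⟩,
    BoundedPS.l1Topology_ne_supTopology, BoundedPS.l1Topology_ne_compactTopology,
    BoundedPS.supTopology_ne_compactTopology⟩
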